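/- Let $X$ be a continuum (a non-empty, compact, connected metric space), and let $n_0\le m_0$ be any positive integers. Then the following two statements are equivalent. 1. $X$ does not have the fixed point property, i.e. there is a continuous map $X\to X$ without a fixed point. 2. There are connected polyhedra $P_1,P_2,P_3,\dots$ and continuous surjections $f_\ell:P_{\ell+1}\to P_\ell$ ($\ell\ge 1$) such that the inverse limit $$P_\infty=\varprojlim\{P_\ell,f_\ell\}_{\ell=1}^{\infty}=\Bigl\{(x_1,x_2,\dots)\in\prod_{\ell\ge 1}P_\ell : x_\ell=f_\ell(x_{\ell+1})\text{ for all }\ell\ge 1\Bigr\}$$ (with the topology induced by the product topology) is homeomorphic to $X$, and there is a continuous map $g:P_\infty\to P_\infty$ such that $$f_{n_0,m_0}(x)\notin T_{n_0,m_0}(g)(x)\quad\text{for every }x\in P_{m_0}.$$ Here a polyhedron is a space homeomorphic to the union of the simplices of a finite geometric simplicial complex in some Euclidean space $\mathbb R^N$; for $n\le m$, $f_{n,m}=f_n\circ f_{n+1}\circ\cdots\circ f_{m-1}:P_m\to P_n$ (the identity if $n=m$); $p_n:P_\infty\to P_n$ is the $n$-th coordinate projection; and $T_{n,m}(g)(x)=p_n\bigl(g(p_m^{-1}(\{x\}))\bigr)\subseteq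 P_n$ for $x\in P_m$. -/

import Mathlib

/-- A topological space has the fixed point property if every continuous self-map of it
has a fixed point. -/
def HasFixedPointProperty (X : Type*) [TopologicalSpace X] : Prop :=
  ∀ h : X → X, Continuous h → ∃ x : X, h x = x

/-- A (compact) polyhedron: a space homeomorphic to the union of the simplices of a finite
geometric simplicial complex in some Euclidean space. -/
def IsPolyhedron (P : Type*) [TopologicalSpace P] : Prop :=
  ∃ (N : ℕ) (K : Geometry.SimplicialComplex ℝ (EuclideanSpace ℝ (Fin N))),
    K.faces.Finite ∧ Nonempty (P ≃ₜ K.space)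

namespace InverseSequence

/-- The inverse limit of `X 0 ← X 1 ← X 2 ← ⋯` with bonding functions `f l : X (l + 1) → X l`,
as a subset of the product of the factor spaces (the product topology induces its topology). -/
def limit {X : ℕ → Type*} (f : ∀ l, X (l + 1) → X l) : Set (∀ l, X l) :=
  {x | ∀ l, x l = f l (x (l + 1))}

/-- The standard projection of the inverse limit onto its `n`-th factor space. -/
def proj {X : ℕ → Type*} (f : ∀ l, X (l + 1) → X l) (n : ℕ) (x : limit f) : X n :=
  x.1 n

/-- The composed bonding function `f_{n,m} = f n ∘ f (n + 1) ∘ ⋯ ∘ f (m - 1) : X m → X n`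
for `n ≤ m`; it is the identity for `n = m`. -/
def bond {X : ℕ → Type*} (f : ∀ l, X (l + 1) → X l) {n m : ℕ} (h : n ≤ m) : X m → X n :=
  Nat.leRec (motive := fun k _ => X k → X n) id (fun k _ F => F ∘ f k) h

/-- The set-valued transformation `T_{n,m}(g)` from `X m` to `Y n` of a function `g` between two
inverse limits: `T_{n,m}(g)(x) = q_n(g(p_m⁻¹(x)))`. -/
def transform {X Y : ℕ → Type*} {f : ∀ l, X (l + 1) → X l} {f' : ∀ l, Y (l + 1) → Y l}
    (n m : ℕ) (g : limit f → limit f') (x : X m) : Set (Y n) :=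
  proj f' n '' (g '' (proj f m ⁻¹' {x}))

end InverseSequence

/-! A fixed-point-free map `h` of a compact space moves every point by at least some `ε > 0`. If `X`
is an inverse limit of connected polyhedra whose projections have no two points at distance `≥ ε` in
a fibre, then `h x` and `x` differ in every coordinate, which gives the condition on `T`.
Conversely, a fixed point of `g` violates that condition at its own projection.

The work lies in `exists_polyhedral_expansion`, where the bonding maps must be onto. A partition of
unity maps `X` to a simplex; while the map is not essential, a carried map misses a point of a face
that is met, and is pushed off that face. Fewer faces are met each time, so this ends in an
essential map. Its image is a subcomplex, covered by every map it carries. Placing the vertices of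
each stage near the values of the previous one gives linear bonding maps that almost commute with
the essential maps. The compositions converge to exactly commuting maps `Λ n`, still carried by the
essential ones, hence onto; so the bonding maps are onto too. -/

/-! ### Essential maps into simplices -/

open Function in
/-- A map `p` into a standard simplex is essential if every map carried by it (each value lies in
the closed face of the simplex spanned by the value of `p`) covers every face met by `p`. -/
def IsEssential {X ι : Type*} [TopologicalSpace X] [Fintype ι] (p : X → ι → ℝ) : Prop :=
  ∀ q : X → ι → ℝ, Continuous q → (∀ x, q x ∈ stdSimplex ℝ ι) →
    (∀ x, support (q x) ⊆ support (p x)) →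
    ∀ t ∈ stdSimplex ℝ ι, ∀ x, support t ⊆ support (p x) → t ∈ Set.range q

open Function in
/-- A map into a simplex that misses a point `t` can be pushed radially away from `t`, off all the
faces that contain `t`. -/
lemma exists_push_off {X ι : Type*} [TopologicalSpace X] [Fintype ι] {q : X → ι → ℝ}
    (hq : Continuous q) (hmem : ∀ x, q x ∈ stdSimplex ℝ ι) {t : ι → ℝ} (ht : t ∈ stdSimplex ℝ ι)
    (hmiss : t ∉ Set.range q) :
    ∃ r : X → ι → ℝ, Continuous r ∧ (∀ x, r x ∈ stdSimplex ℝ ι) ∧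
      (∀ x, support (r x) ⊆ support (q x)) ∧ ∀ x, ¬ support t ⊆ support (r x) := by
  classical
  set σ : Finset ι := Finset.univ.filter (fun i => t i ≠ 0) with hσ
  have hne : σ.Nonempty := by
    by_contra h
    rw [Finset.not_nonempty_iff_eq_empty, hσ, Finset.filter_eq_empty_iff] at h
    have h0 : ∑ i, t i = 0 := Finset.sum_eq_zero fun i hi => by simpa using h hi
    linarith [ht.2]
  have hpos : ∀ i ∈ σ, 0 < t i := fun i hi =>
    lt_of_le_of_ne (ht.1 i) (Ne.symm (Finset.mem_filter.1 hi).2)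
  -- `c x` is the largest multiple of `t` that can be subtracted from `q x` without a negative
  -- coordinate. The ray from `t` through `q x` leaves the face spanned by `q x` at `(q x - c x • t)
  -- / (1 - c x)`, where a coordinate in the support of `t` vanishes.
  set c : X → ℝ := fun x => σ.inf' hne (fun i => q x i / t i) with hc
  have hccont : Continuous c :=
    Continuous.finset_inf'_apply hne fun i _ => (((continuous_apply i).comp hq).div_const _)
  have hc0 : ∀ x, 0 ≤ c x := fun x =>
    Finset.le_inf' _ _ fun i hi => div_nonneg ((hmem x).1 i) (ht.1 i)
  have hle : ∀ x i, c x * t i ≤ q x i := by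
    intro x i
    by_cases hi : i ∈ σ
    · exact (le_div_iff₀ (hpos i hi)).1 (Finset.inf'_le _ hi)
    · have : t i = 0 := by simpa [hσ] using hi
      simpa [this] using (hmem x).1 i
  have hc1 : ∀ x, c x < 1 := by
    intro x
    by_contra! h
    have hle' : ∀ i ∈ Finset.univ, t i ≤ q x i := fun i _ =>
      le_trans (le_mul_of_one_le_left (ht.1 i) h) (hle x i)
    have := (Finset.sum_eq_sum_iff_of_le hle').1 (by rw [ht.2, (hmem x).2])
    exact hmiss ⟨x, funext fun i => (this i (Finset.mem_univ i)).symm⟩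
  refine ⟨fun x i => (q x i - c x * t i) / (1 - c x), ?_, ?_, ?_, ?_⟩
  · refine continuous_pi fun i => ?_
    refine Continuous.div ?_ (continuous_const.sub hccont) fun x => (sub_pos.2 (hc1 x)).ne'
    exact ((continuous_apply i).comp hq).sub (hccont.mul continuous_const)
  · refine fun x => ⟨fun i => div_nonneg (sub_nonneg.2 (hle x i)) (sub_pos.2 (hc1 x)).le, ?_⟩
    rw [← Finset.sum_div, Finset.sum_sub_distrib, ← Finset.mul_sum, ht.2, (hmem x).2, mul_one]
    exact div_self (sub_pos.2 (hc1 x)).ne'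
  · intro x i hi hqi
    apply hi
    have h1 := hle x i
    have h2 : 0 ≤ c x * t i := mul_nonneg (hc0 x) (ht.1 i)
    simp only [hqi] at h1 ⊢
    rw [le_antisymm h1 h2]
    simp
  · intro x hsub
    obtain ⟨i, hi, hci⟩ := Finset.exists_mem_eq_inf' hne (fun i => q x i / t i)
    refine hsub (show i ∈ support t from (hpos i hi).ne') ?_
    have : c x * t i = q x i := by
      change σ.inf' hne _ * t i = _
      rw [hci, div_mul_cancel₀ _ (hpos i hi).ne']
    simp [this]

open Function in
/-- Every map into a simplex carries an essential map. -/
lemma exists_isEssential {X ι : Type*} [TopologicalSpace X] [Fintype ι] (p : X → ι → ℝ)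
    (hp : Continuous p) (hmem : ∀ x, p x ∈ stdSimplex ℝ ι) :
    ∃ q : X → ι → ℝ, Continuous q ∧ (∀ x, q x ∈ stdSimplex ℝ ι) ∧
      (∀ x, support (q x) ⊆ support (p x)) ∧ IsEssential q := by
  induction hn : Set.ncard {s : Finset ι | ∃ x, (s : Set ι) ⊆ support (p x)}
    using Nat.strong_induction_on generalizing p with
  | _ n ih =>
  by_cases hess : IsEssential p
  · exact ⟨p, hp, hmem, fun _ => subset_rfl, hess⟩
  unfold IsEssential at hess
  push Not at hess
  obtain ⟨q, hq, hqmem, hqp, t, ht, x₀, htx, hmiss⟩ := hess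
  obtain ⟨r, hr, hrmem, hrq, hrt⟩ := exists_push_off hq hqmem ht hmiss
  -- The support of `t` is a face met by `p` but no longer by `r`.
  have hlt : Set.ncard {s : Finset ι | ∃ x, (s : Set ι) ⊆ support (r x)} < n := by
    rw [← hn]
    refine Set.ncard_lt_ncard ⟨?_, ?_⟩ (Set.toFinite _)
    · rintro s ⟨x, hs⟩
      exact ⟨x, hs.trans ((hrq x).trans (hqp x))⟩
    · intro h
      obtain ⟨x, hx⟩ := h (show (support t).toFinite.toFinset ∈ _ from ⟨x₀, by simpa using htx⟩)
      exact hrt x (by simpa using hx)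
  obtain ⟨u, hu, humem, hur, hess⟩ := ih _ hlt r hr hrmem rfl
  exact ⟨u, hu, humem, fun x => (hur x).trans ((hrq x).trans (hqp x)), hess⟩

/-! ### Fine maps and uniform approximation -/

open Function in
/-- A compact metric space has maps into simplices for which the preimages of the open stars of the
vertices are small. -/
lemma exists_fine_map (X : Type*) [MetricSpace X] [CompactSpace X] {ε : ℝ} (hε : 0 < ε) :
    ∃ (N : ℕ) (p : X → Fin N → ℝ), Continuous p ∧ (∀ x, p x ∈ stdSimplex ℝ (Fin N)) ∧
      ∀ i x y, i ∈ support (p x) → i ∈ support (p y) → dist x y < ε := by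
  obtain ⟨s, -, hs, hcov⟩ := finite_cover_balls_of_compact (isCompact_univ (X := X)) (half_pos hε)
  obtain ⟨N, c, hc⟩ : ∃ (N : ℕ) (c : Fin N → X), Set.range c = s := by
    have := hs.to_subtype
    obtain ⟨N, ⟨e⟩⟩ := Finite.exists_equiv_fin s
    exact ⟨N, fun i => e.symm i, by
      change Set.range (Subtype.val ∘ e.symm) = s
      rw [EquivLike.range_comp, Subtype.range_coe]⟩
  set w : X → Fin N → ℝ := fun x i => max 0 (ε / 2 - dist x (c i)) with hw
  have hw0 : ∀ x i, 0 ≤ w x i := fun x i => le_max_left _ _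
  have hwc : ∀ i, Continuous fun x => w x i := fun i => by fun_prop
  have hS : ∀ x, 0 < ∑ i, w x i := by
    intro x
    obtain ⟨y, hy, hxy⟩ := Set.mem_iUnion₂.1 (hcov (Set.mem_univ x))
    obtain ⟨i, rfl⟩ := hc.symm ▸ hy
    exact Finset.sum_pos' (fun i _ => hw0 x i)
      ⟨i, Finset.mem_univ i, lt_max_of_lt_right (sub_pos.2 hxy)⟩
  have hsupp : ∀ x i, w x i / ∑ j, w x j ≠ 0 → dist x (c i) < ε / 2 := by
    intro x i h
    by_contra! h'
    exact h (by simp [hw, h'])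
  refine ⟨N, fun x i => w x i / ∑ j, w x j, ?_, ?_, ?_⟩
  · exact continuous_pi fun i =>
      (hwc i).div (continuous_finsetSum _ fun j _ => hwc j) fun x => (hS x).ne'
  · refine fun x => ⟨fun i => div_nonneg (hw0 x i) (hS x).le, ?_⟩
    rw [← Finset.sum_div, div_self (hS x).ne']
  · intro i x y hx hy
    have h1 := hsupp x i hx
    have h2 := hsupp y i hy
    linarith [dist_triangle_right x y (c i)]

open Function in
/-- A continuous map into a simplex is locally, and uniformly so, close to a point that lies in
all the faces spanned by nearby values. -/
lemma exists_uniform_approx {X ι : Type*} [MetricSpace X] [CompactSpace X] [Fintype ι]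
    {p : X → ι → ℝ} (hp : Continuous p) (hmem : ∀ x, p x ∈ stdSimplex ℝ ι) {δ : ℝ} (hδ : 0 < δ) :
    ∃ ρ > 0, ∀ x₀, ∃ m ∈ stdSimplex ℝ ι, ∀ x, dist x x₀ < ρ →
      support m ⊆ support (p x) ∧ ∑ i, |m i - p x i| ≤ δ := by
  have hcont : ∀ i, Continuous fun x => p x i := fun i => (continuous_apply i).comp hp
  -- On `W a` the point `p a` serves as `m`; a Lebesgue number of this cover is the uniform `ρ`.
  set W : X → Set X := fun a =>
    (⋂ i ∈ support (p a), {x | p x i ≠ 0}) ∩ {x | ∑ i, |p a i - p x i| < δ} with hW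
  have hopen : ∀ a, IsOpen (W a) := by
    intro a
    refine IsOpen.inter ?_ ?_
    · exact (Set.toFinite _).isOpen_biInter fun i _ => isOpen_ne_fun (hcont i) continuous_const
    · exact isOpen_lt (continuous_finsetSum _ fun i _ => (continuous_const.sub (hcont i)).abs)
        continuous_const
  have hcover : (Set.univ : Set X) ⊆ ⋃ a, W a := fun a _ =>
    Set.mem_iUnion.2 ⟨a, by simp [hW, hδ]⟩
  obtain ⟨ρ, hρ, h⟩ := lebesgue_number_lemma_of_metric isCompact_univ hopen hcover
  refine ⟨ρ, hρ, fun x₀ => ?_⟩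
  obtain ⟨a, ha⟩ := h x₀ (Set.mem_univ _)
  refine ⟨p a, hmem a, fun x hx => ?_⟩
  obtain ⟨h1, h2⟩ := ha (Metric.mem_ball.2 hx)
  exact ⟨fun i hi => Set.mem_iInter₂.1 h1 i hi, le_of_lt h2⟩

/-! ### Linear extension from vertices -/

/-- The linear map between coordinate spaces with prescribed values at the basis vectors. -/
def vertexExtend {κ ι : Type*} [Fintype κ] (M : κ → ι → ℝ) (t : κ → ℝ) (i : ι) : ℝ :=
  ∑ v, t v * M v i

section vertexExtend

variable {κ ι : Type*} [Fintype κ] {M : κ → ι → ℝ}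

lemma continuous_vertexExtend (M : κ → ι → ℝ) : Continuous (vertexExtend M) := by
  unfold vertexExtend
  fun_prop

open Function in
lemma support_vertexExtend_subset {t : κ → ℝ} {T : Set ι}
    (h : ∀ v ∈ support t, support (M v) ⊆ T) : support (vertexExtend M t) ⊆ T := by
  intro i hi
  by_contra hT
  refine hi (Finset.sum_eq_zero fun v _ => ?_)
  by_cases hv : t v = 0
  · simp [hv]
  · have : M v i = 0 := by
      by_contra h'
      exact hT (h v hv h')
    simp [this]

variable [Fintype ι]

lemma vertexExtend_mem_stdSimplex (hM : ∀ v, M v ∈ stdSimplex ℝ ι) {t : κ → ℝ}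
    (ht : t ∈ stdSimplex ℝ κ) : vertexExtend M t ∈ stdSimplex ℝ ι := by
  refine ⟨fun i => Finset.sum_nonneg fun v _ => mul_nonneg (ht.1 v) ((hM v).1 i), ?_⟩
  unfold vertexExtend
  rw [Finset.sum_comm]
  simp_rw [← Finset.mul_sum, (hM _).2, mul_one]
  exact ht.2

/-- Working in the `ℓ¹` distance keeps errors from growing under repeated bonding maps. -/
lemma sum_abs_vertexExtend_sub_le (hM : ∀ v, M v ∈ stdSimplex ℝ ι) (t u : κ → ℝ) :
    ∑ i, |vertexExtend M t i - vertexExtend M u i| ≤ ∑ v, |t v - u v| := by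
  calc ∑ i, |vertexExtend M t i - vertexExtend M u i|
      = ∑ i, |∑ v, (t v - u v) * M v i| := by
        simp_rw [vertexExtend, ← Finset.sum_sub_distrib, sub_mul]
    _ ≤ ∑ i, ∑ v, |t v - u v| * M v i := by
        refine Finset.sum_le_sum fun i _ => (Finset.abs_sum_le_sum_abs _ _).trans_eq ?_
        exact Finset.sum_congr rfl fun v _ => by rw [abs_mul, abs_of_nonneg ((hM v).1 i)]
    _ = ∑ v, |t v - u v| := by
        rw [Finset.sum_comm]
        simp_rw [← Finset.mul_sum, (hM _).2, mul_one]

open Function in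
lemma sum_abs_vertexExtend_sub_le_of_mem_stdSimplex {t : κ → ℝ} (ht : t ∈ stdSimplex ℝ κ)
    {a : ι → ℝ} {δ : ℝ} (h : ∀ v ∈ support t, ∑ i, |M v i - a i| ≤ δ) :
    ∑ i, |vertexExtend M t i - a i| ≤ δ := by
  calc ∑ i, |vertexExtend M t i - a i|
      = ∑ i, |∑ v, t v * (M v i - a i)| := by
        simp_rw [mul_sub, Finset.sum_sub_distrib, ← Finset.sum_mul, ht.2, one_mul, vertexExtend]
    _ ≤ ∑ i, ∑ v, t v * |M v i - a i| := by
        refine Finset.sum_le_sum fun i _ => (Finset.abs_sum_le_sum_abs _ _).trans_eq ?_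
        exact Finset.sum_congr rfl fun v _ => by rw [abs_mul, abs_of_nonneg (ht.1 v)]
    _ = ∑ v, t v * ∑ i, |M v i - a i| := by
        rw [Finset.sum_comm]
        simp_rw [← Finset.mul_sum]
    _ ≤ ∑ v, t v * δ := by
        refine Finset.sum_le_sum fun v _ => ?_
        by_cases hv : t v = 0
        · simp [hv]
        · exact mul_le_mul_of_nonneg_left (h v hv) (ht.1 v)
    _ = δ := by rw [← Finset.sum_mul, ht.2, one_mul]

end vertexExtend

/-! ### Realization as polyhedra -/

/-- The points of a face of the standard simplex, as a convex hull in Euclidean space. -/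
lemma mem_convexHull_image_single_iff {N : ℕ} (σ : Finset (Fin N)) (z : EuclideanSpace ℝ (Fin N)) :
    z ∈ convexHull ℝ ((fun i => EuclideanSpace.single i (1 : ℝ)) '' (σ : Set (Fin N))) ↔
      z.ofLp ∈ stdSimplex ℝ (Fin N) ∧ Function.support z.ofLp ⊆ σ := by
  constructor
  · have hconv : Convex ℝ {z : EuclideanSpace ℝ (Fin N) |
        z.ofLp ∈ stdSimplex ℝ (Fin N) ∧ Function.support z.ofLp ⊆ σ} := by
      rintro x ⟨hx, hx'⟩ y ⟨hy, hy'⟩ a b ha hb hab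
      refine ⟨by simpa using convex_stdSimplex ℝ (Fin N) hx hy ha hb hab, fun i hi => ?_⟩
      by_contra h
      have h1 : x.ofLp i = 0 := by by_contra h'; exact h (hx' h')
      have h2 : y.ofLp i = 0 := by by_contra h'; exact h (hy' h')
      exact hi (by simp [h1, h2])
    refine fun h => convexHull_min ?_ hconv h
    rintro _ ⟨i, hi, rfl⟩
    refine ⟨by simpa using single_mem_stdSimplex ℝ i, ?_⟩
    intro j hj
    have : j = i := by
      by_contra h'
      exact hj (by simp [h'])
    exact this ▸ hi
  · rintro ⟨hz, hσ⟩
    have hzero : ∀ i ∉ σ, z.ofLp i = 0 := fun i hi => by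
      by_contra h
      exact hi (hσ h)
    have hsum : z = ∑ i ∈ σ, z.ofLp i • EuclideanSpace.single i (1 : ℝ) := by
      ext j
      by_cases hj : j ∈ σ
      · simp [Pi.single_apply, hj]
      · simp [Pi.single_apply, hj, hzero j hj]
    rw [hsum]
    refine (convex_convexHull ℝ _).sum_mem (fun i _ => hz.1 i) ?_ fun i hi =>
      subset_convexHull ℝ _ (Set.mem_image_of_mem _ hi)
    rw [← hz.2]
    exact Finset.sum_subset (Finset.subset_univ _) fun i _ hi => hzero i hi

/-- The subcomplex of the standard simplex given by a downward closed family of faces is a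
polyhedron. -/
lemma isPolyhedron_of_faces {N : ℕ} (A : Set (Finset (Fin N)))
    (hA : ∀ s ∈ A, ∀ t ⊆ s, t ∈ A) {P : Set (Fin N → ℝ)}
    (hP : ∀ t, t ∈ P ↔ t ∈ stdSimplex ℝ (Fin N) ∧ ∃ s ∈ A, Function.support t ⊆ s) :
    IsPolyhedron P := by
  classical
  let L : PreAbstractSimplicialComplex (Fin N) :=
    { faces := {s | s ∈ A ∧ s.Nonempty}
      isRelLowerSet_faces := fun s hs => ⟨hs.2, fun t hts ht => ⟨hA s hs.1 t hts, ht⟩⟩ }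
  have hli : LinearIndependent ℝ fun i : Fin N => EuclideanSpace.single i (1 : ℝ) := by
    have h : (fun i : Fin N => EuclideanSpace.single i (1 : ℝ)) =
        (EuclideanSpace.basisFun (Fin N) ℝ).toBasis := by
      ext1 i
      rw [OrthonormalBasis.coe_toBasis, EuclideanSpace.basisFun_apply]
    rw [h]
    exact (EuclideanSpace.basisFun (Fin N) ℝ).toBasis.linearIndependent
  let K : Geometry.SimplicialComplex ℝ (EuclideanSpace ℝ (Fin N)) :=
    Geometry.SimplicialComplex.ofAffineIndependent
      (L.map (fun i => EuclideanSpace.single i (1 : ℝ))) (by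
        refine hli.affineIndependent.range.mono fun x hx => ?_
        simp only [Set.mem_iUnion, Finset.mem_coe] at hx
        obtain ⟨_, ⟨_, _, rfl⟩, hx⟩ := hx
        obtain ⟨i, -, rfl⟩ := Finset.mem_image.1 hx
        exact ⟨i, rfl⟩)
  have hfaces : K.faces = Finset.image (fun i => EuclideanSpace.single i (1 : ℝ)) ''
      {s | s ∈ A ∧ s.Nonempty} := rfl
  refine ⟨N, K, hfaces ▸ (Set.toFinite _).image _, ⟨?_⟩⟩
  refine ((EuclideanSpace.equiv (Fin N) ℝ).symm.toHomeomorph.image P).trans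
    (Homeomorph.setCongr ?_)
  ext z
  rw [Geometry.SimplicialComplex.mem_space_iff, hfaces]
  have hz : z ∈ (EuclideanSpace.equiv (Fin N) ℝ).symm.toHomeomorph '' P ↔ z.ofLp ∈ P := by
    constructor
    · rintro ⟨t, ht, rfl⟩
      exact ht
    · exact fun h => ⟨z.ofLp, h, rfl⟩
  rw [hz, hP]
  simp only [Set.exists_mem_image, Finset.coe_image, mem_convexHull_image_single_iff]
  constructor
  · rintro ⟨h1, s, hs, h2⟩
    refine ⟨s, ⟨hs, ?_⟩, h1, h2⟩
    by_contra h
    rw [Finset.not_nonempty_iff_eq_empty] at h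
    subst h
    have : ∑ i, z.ofLp i = 0 := Finset.sum_eq_zero fun i _ => by
      by_contra h'
      exact absurd (h2 h') (by simp)
    linarith [h1.2]
  · rintro ⟨s, hs, h1, h2⟩
    exact ⟨h1, s, hs.1, h2⟩

/-! ### Sequences of essential maps -/

/-- An essential continuous map of a space into a standard simplex. -/
structure EssentialMap (X : Type*) [TopologicalSpace X] where
  /-- the number of vertices of the simplex -/
  N : ℕ
  /-- the underlying function -/
  toFun : X → Fin N → ℝ
  continuous : Continuous toFun
  mem_stdSimplex : ∀ x, toFun x ∈ stdSimplex ℝ (Fin N)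
  isEssential : IsEssential toFun

namespace EssentialMap

open Function

variable {X : Type*}

/-- Essentiality tested on the map itself makes its image the full subcomplex of the faces it meets.
-/
lemma mem_range_iff [TopologicalSpace X] (E : EssentialMap X) (t : Fin E.N → ℝ) :
    t ∈ Set.range E.toFun ↔
      t ∈ stdSimplex ℝ (Fin E.N) ∧ ∃ x, support t ⊆ support (E.toFun x) := by
  constructor
  · rintro ⟨x, rfl⟩
    exact ⟨E.mem_stdSimplex x, x, subset_rfl⟩
  · rintro ⟨ht, x, hx⟩
    exact E.isEssential _ E.continuous E.mem_stdSimplex (fun _ => subset_rfl) t ht x hx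

lemma isPolyhedron_range [TopologicalSpace X] (E : EssentialMap X) :
    IsPolyhedron (Set.range E.toFun) := by
  refine isPolyhedron_of_faces {s | ∃ x, (s : Set (Fin E.N)) ⊆ support (E.toFun x)}
    (fun s ⟨x, hs⟩ t ht => ⟨x, (Finset.coe_subset.2 ht).trans hs⟩) fun t => ?_
  rw [mem_range_iff]
  refine and_congr_right fun _ => ⟨fun ⟨x, hx⟩ => ?_, fun ⟨s, ⟨x, hs⟩, hst⟩ => ⟨x, hst.trans hs⟩⟩
  exact ⟨(support t).toFinite.toFinset, ⟨x, by simpa using hx⟩, by simp⟩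

variable [MetricSpace X]

/-- The preimages of the open stars of the vertices have diameter at most `ε`. -/
def IsFine (E : EssentialMap X) (ε : ℝ) : Prop :=
  ∀ i x y, i ∈ support (E.toFun x) → i ∈ support (E.toFun y) → dist x y < ε

lemma exists_isFine [CompactSpace X] {ε : ℝ} (hε : 0 < ε) : ∃ E : EssentialMap X, E.IsFine ε := by
  obtain ⟨N, p, hp, hmem, hfine⟩ := exists_fine_map X hε
  obtain ⟨q, hq, hqmem, hqp, hess⟩ := exists_isEssential p hp hmem
  exact ⟨⟨N, q, hq, hqmem, hess⟩, fun i x y hx hy => hfine i x y (hqp x hx) (hqp y hy)⟩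

/-- The vertices of the simplex of `E'` are placed, by `M`, close to the values of `E`. -/
def IsBonding (E E' : EssentialMap X) (δ : ℝ) (M : Fin E'.N → Fin E.N → ℝ) : Prop :=
  (∀ v, M v ∈ stdSimplex ℝ (Fin E.N)) ∧ ∀ x, ∀ v ∈ support (E'.toFun x),
    support (M v) ⊆ support (E.toFun x) ∧ ∑ i, |M v i - E.toFun x i| ≤ δ

lemma exists_isFine_isBonding [CompactSpace X] [Nonempty X] (E : EssentialMap X) {ε δ : ℝ}
    (hε : 0 < ε) (hδ : 0 < δ) : ∃ E' : EssentialMap X, E'.IsFine ε ∧ ∃ M, IsBonding E E' δ M := by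
  obtain ⟨ρ, hρ, h⟩ := exists_uniform_approx E.continuous E.mem_stdSimplex hδ
  obtain ⟨E', hE'⟩ := exists_isFine (X := X) (lt_min hε hρ)
  refine ⟨E', fun i x y hx hy => (hE' i x y hx hy).trans_le (min_le_left _ _), ?_⟩
  -- The star of `v` has preimage within `ρ` of one point, so a single position for `v` suits all
  -- `x` there. If the preimage is empty, any centre will do.
  have hx₀ : ∀ v, ∃ x₀, ∀ x, v ∈ support (E'.toFun x) → dist x x₀ < ρ := by
    intro v
    by_cases hv : ∃ x₀, v ∈ support (E'.toFun x₀)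
    · obtain ⟨x₀, hx₀⟩ := hv
      exact ⟨x₀, fun x hx => (hE' v x x₀ hx hx₀).trans_le (min_le_right _ _)⟩
    · exact ⟨Classical.arbitrary X, fun x hx => absurd ⟨x, hx⟩ hv⟩
  choose c hc using hx₀
  choose m hm hmx using h
  exact ⟨fun v => m (c v), fun v => hm _, fun x v hv => hmx _ x (hc v x hv)⟩

/-- Every compact metric space has a sequence of ever finer essential maps, with vertex placements
under which they almost commute. -/
lemma exists_sequence (X : Type*) [MetricSpace X] [CompactSpace X] [Nonempty X] {ε : ℝ}
    (hε : 0 < ε) :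
    ∃ (E : ℕ → EssentialMap X) (M : ∀ n, Fin (E (n + 1)).N → Fin (E n).N → ℝ),
      (∀ n, (E n).IsFine (min ε ((1 / 2) ^ n))) ∧
      ∀ n, IsBonding (E n) (E (n + 1)) ((1 / 2) ^ n) (M n) := by
  have hpos : ∀ n : ℕ, 0 < min ε ((1 / 2) ^ n) := fun n => lt_min hε (by positivity)
  obtain ⟨E₀, hE₀⟩ := exists_isFine (X := X) (hpos 0)
  choose next hfine M hM using fun (n : ℕ) (E : EssentialMap X) =>
    E.exists_isFine_isBonding (hpos (n + 1)) (δ := (1 / 2) ^ n) (by positivity)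
  refine ⟨fun n => Nat.rec E₀ next n, fun n => M n _, fun n => ?_, fun n => hM n _⟩
  cases n with
  | zero => exact hE₀
  | succ n => exact hfine n _

/-! ### Correction to commuting maps -/

section Limit

variable {E : ℕ → EssentialMap X} {M : ∀ n, Fin (E (n + 1)).N → Fin (E n).N → ℝ}

lemma IsBonding.vertexExtend_mem_range {E E' : EssentialMap X} {δ : ℝ}
    {M : Fin E'.N → Fin E.N → ℝ} (h : IsBonding E E' δ M) {t : Fin E'.N → ℝ}
    (ht : t ∈ Set.range E'.toFun) : vertexExtend M t ∈ Set.range E.toFun := by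
  obtain ⟨x, rfl⟩ := ht
  exact (E.mem_range_iff _).2 ⟨vertexExtend_mem_stdSimplex h.1 (E'.mem_stdSimplex x), x,
    support_vertexExtend_subset fun v hv => (h.2 x v hv).1⟩

/-- The composition of the map of stage `n + j` with `j` bonding maps. -/
noncomputable def approx (E : ℕ → EssentialMap X)
    (M : ∀ n, Fin (E (n + 1)).N → Fin (E n).N → ℝ) : ∀ (_ n : ℕ), X → Fin (E n).N → ℝ
  | 0, n, x => (E n).toFun x
  | j + 1, n, x => vertexExtend (M n) (approx E M j (n + 1) x)

lemma continuous_approx (j n : ℕ) : Continuous (approx E M j n) := by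
  induction j generalizing n with
  | zero => exact (E n).continuous
  | succ j ih => exact (continuous_vertexExtend _).comp (ih (n + 1))

lemma approx_mem {δ : ℕ → ℝ} (hM : ∀ n, IsBonding (E n) (E (n + 1)) (δ n) (M n)) (j n : ℕ) (x : X) :
    approx E M j n x ∈ stdSimplex ℝ (Fin (E n).N) ∧
      support (approx E M j n x) ⊆ support ((E n).toFun x) := by
  induction j generalizing n with
  | zero => exact ⟨(E n).mem_stdSimplex x, subset_rfl⟩
  | succ j ih =>
    exact ⟨vertexExtend_mem_stdSimplex (hM n).1 (ih (n + 1)).1,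
      support_vertexExtend_subset fun v hv => ((hM n).2 x v ((ih (n + 1)).2 hv)).1⟩

/-- The two compositions differ only by the error made at stage `n + j`, which the remaining bonding
maps do not enlarge. -/
lemma sum_abs_approx_sub_le (hM : ∀ n, IsBonding (E n) (E (n + 1)) ((1 / 2) ^ n) (M n))
    (j n : ℕ) (x : X) :
    ∑ i, |approx E M (j + 1) n x i - approx E M j n x i| ≤ (1 / 2) ^ (n + j) := by
  induction j generalizing n with
  | zero =>
    exact sum_abs_vertexExtend_sub_le_of_mem_stdSimplex ((E (n + 1)).mem_stdSimplex x)
      fun v hv => ((hM n).2 x v hv).2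
  | succ j ih =>
    refine (sum_abs_vertexExtend_sub_le (hM n).1 _ _).trans ((ih (n + 1)).trans_eq ?_)
    congr 1
    omega

lemma dist_approx_le (hM : ∀ n, IsBonding (E n) (E (n + 1)) ((1 / 2) ^ n) (M n))
    (n : ℕ) (x : X) (j : ℕ) :
    dist (approx E M j n x) (approx E M (j + 1) n x) ≤ 1 * (1 / 2) ^ j := by
  rw [dist_comm, dist_pi_le_iff (by positivity)]
  intro i
  rw [Real.dist_eq]
  calc _ ≤ ∑ i, |approx E M (j + 1) n x i - approx E M j n x i| :=
        Finset.single_le_sum (f := fun i => |approx E M (j + 1) n x i - approx E M j n x i|)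
          (fun _ _ => abs_nonneg _) (Finset.mem_univ i)
    _ ≤ (1 / 2) ^ (n + j) := sum_abs_approx_sub_le hM j n x
    _ ≤ 1 * (1 / 2) ^ j := by
        rw [one_mul]
        exact pow_le_pow_of_le_one (by norm_num) (by norm_num) (by omega)

open Filter Topology in
/-- An almost commuting sequence of essential maps can be corrected to a commuting one. -/
lemma exists_limit (hM : ∀ n, IsBonding (E n) (E (n + 1)) ((1 / 2) ^ n) (M n)) :
    ∃ Λ : ∀ n, X → Fin (E n).N → ℝ, (∀ n, Continuous (Λ n)) ∧
      (∀ n x, Λ n x ∈ stdSimplex ℝ (Fin (E n).N)) ∧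
      (∀ n x, support (Λ n x) ⊆ support ((E n).toFun x)) ∧
      ∀ n x, Λ n x = vertexExtend (M n) (Λ (n + 1) x) := by
  have hex : ∀ n x, ∃ a, Tendsto (fun j => approx E M j n x) atTop (𝓝 a) := fun n x =>
    cauchySeq_tendsto_of_complete
      (cauchySeq_of_le_geometric (1 / 2) 1 (by norm_num) (dist_approx_le hM n x))
  choose Λ hΛ using hex
  refine ⟨Λ, fun n => ?_, fun n x => ?_, fun n x i hi => ?_, fun n x => ?_⟩
  · have hunif : TendstoUniformly (fun j => approx E M j n) (Λ n) atTop := by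
      rw [Metric.tendstoUniformly_iff]
      intro e he
      have hlim : Tendsto (fun j : ℕ => 1 * (1 / 2 : ℝ) ^ j / (1 - 1 / 2)) atTop (𝓝 0) := by
        simpa using ((tendsto_pow_atTop_nhds_zero_of_lt_one (r := (1 / 2 : ℝ)) (by norm_num)
          (by norm_num)).const_mul 1).div_const (1 - 1 / 2)
      filter_upwards [hlim.eventually_lt_const he] with j hj x
      rw [dist_comm]
      exact (dist_le_of_le_geometric_of_tendsto (1 / 2) 1 (by norm_num) (dist_approx_le hM n x)
        (hΛ n x) j).trans_lt hj
    exact hunif.continuous (Frequently.of_forall fun j => continuous_approx j n)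
  · exact (isClosed_stdSimplex ℝ _).mem_of_tendsto (hΛ n x)
      (Eventually.of_forall fun j => (approx_mem hM j n x).1)
  · by_contra h
    refine hi (tendsto_nhds_unique ((continuous_apply i).continuousAt.tendsto.comp (hΛ n x)) ?_)
    refine tendsto_const_nhds.congr fun j => ?_
    by_contra h'
    exact h ((approx_mem hM j n x).2 (Ne.symm h'))
  · exact tendsto_nhds_unique ((tendsto_add_atTop_iff_nat 1).2 (hΛ n x))
      (((continuous_vertexExtend (M n)).tendsto _).comp (hΛ (n + 1) x))

end Limit

end EssentialMap

/-! ### The transformation and fixed points -/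

namespace InverseSequence

variable {Y : ℕ → Type*} {f : ∀ l, Y (l + 1) → Y l}

lemma bond_proj {n m : ℕ} (h : n ≤ m) (y : limit f) : bond f h (proj f m y) = proj f n y := by
  induction m, h using Nat.le_induction with
  | base => simp [bond]
  | succ k hk ih =>
    have hy : proj f k y = f k (proj f (k + 1) y) := y.2 k
    rw [← ih, hy]
    simp [bond, Nat.leRec_succ _ _ hk]

lemma bond_notMem_transform {n m : ℕ} (h : n ≤ m) {g : limit f → limit f}
    (hg : ∀ y, proj f n (g y) ≠ proj f n y) (x : Y m) : bond f h x ∉ transform n m g x := by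
  rintro ⟨_, ⟨y, rfl, rfl⟩, hy⟩
  exact hg y (by rw [hy, bond_proj])

lemma proj_ne_of_bond_notMem_transform {n m : ℕ} (h : n ≤ m) {g : limit f → limit f}
    (hg : ∀ x, bond f h x ∉ transform n m g x) (y : limit f) : g y ≠ y := by
  intro hy
  refine hg (proj f m y) ⟨g y, ⟨y, rfl, rfl⟩, ?_⟩
  rw [hy, bond_proj]

end InverseSequence

/-! ### Polyhedral expansion and the equivalence -/

/-- Every continuum is the inverse limit of connected polyhedra with surjective bonding maps, and
the projections can be chosen to be `ε`-maps. -/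
theorem exists_polyhedral_expansion (X : Type*) [MetricSpace X] [CompactSpace X]
    [ConnectedSpace X] {ε : ℝ} (hε : 0 < ε) :
    ∃ (P : ℕ → Type) (_ : ∀ l, TopologicalSpace (P l)) (f : ∀ l, P (l + 1) → P l),
      (∀ l, IsPolyhedron (P l) ∧ ConnectedSpace (P l)) ∧
      (∀ l, Continuous (f l) ∧ Function.Surjective (f l)) ∧
      ∃ φ : X ≃ₜ InverseSequence.limit f, ∀ n x y,
        InverseSequence.proj f n (φ x) = InverseSequence.proj f n (φ y) → dist x y < ε := by
  obtain ⟨E, M, hfine, hM⟩ := EssentialMap.exists_sequence X hε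
  obtain ⟨Λ, hΛ, hΛmem, hΛE, hΛM⟩ := EssentialMap.exists_limit hM
  have hrange : ∀ n x, Λ n x ∈ Set.range (E n).toFun := fun n x =>
    ((E n).mem_range_iff _).2 ⟨hΛmem n x, x, hΛE n x⟩
  have hsurj : ∀ n, ∀ t ∈ Set.range (E n).toFun, t ∈ Set.range (Λ n) := by
    rintro n _ ⟨x, rfl⟩
    exact (E n).isEssential _ (hΛ n) (hΛmem n) (hΛE n) _ ((E n).mem_stdSimplex x) x subset_rfl
  have hsmall : ∀ n x y, Λ n x = Λ n y → dist x y < min ε ((1 / 2) ^ n) := by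
    intro n x y hxy
    obtain ⟨i, hi⟩ : ∃ i, Λ n x i ≠ 0 := by
      by_contra! h
      simpa [h] using (hΛmem n x).2
    exact hfine n i x y (hΛE n x hi) (hΛE n y (show Λ n y i ≠ 0 from hxy ▸ hi))
  let P : ℕ → Type := fun n => Set.range (E n).toFun
  let _ : ∀ n, TopologicalSpace (P n) := fun n => instTopologicalSpaceSubtype
  let f : ∀ l, P (l + 1) → P l := fun l t =>
    ⟨vertexExtend (M l) t, (hM l).vertexExtend_mem_range t.2⟩
  have hf : ∀ l, Continuous (f l) := fun l =>
    ((continuous_vertexExtend _).comp continuous_subtype_val).subtype_mk _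
  have hcomm : ∀ l x, (⟨Λ l x, hrange l x⟩ : P l) =
      f l ⟨Λ (l + 1) x, hrange (l + 1) x⟩ := fun l x => Subtype.ext (hΛM l x)
  let φ : X → InverseSequence.limit f := fun x =>
    ⟨fun l => (⟨Λ l x, hrange l x⟩ : P l), fun l => hcomm l x⟩
  have hφ : Continuous φ := (continuous_pi fun l => (hΛ l).subtype_mk _).subtype_mk _
  have hproj : ∀ n x, (InverseSequence.proj f n (φ x)).1 = Λ n x := fun _ _ => rfl
  have hinj : Function.Injective φ := by
    intro x y hxy
    refine dist_le_zero.1 (ge_of_tendsto' (tendsto_pow_atTop_nhds_zero_of_lt_one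
      (r := (1 / 2 : ℝ)) (by norm_num) (by norm_num)) fun n => ?_)
    exact ((hsmall n x y (by rw [← hproj, ← hproj, hxy])).trans_le (min_le_right _ _)).le
  have hφsurj : Function.Surjective φ := by
    intro y
    have hclosed : ∀ n, IsClosed {x | Λ n x = y.1 n} := fun n =>
      isClosed_eq (hΛ n) continuous_const
    -- The fibres of the `Λ n` over the coordinates of `y` are nested by commutation, and nonempty
    -- and compact.
    obtain ⟨x, hx⟩ := IsCompact.nonempty_iInter_of_sequence_nonempty_isCompact_isClosed
      (fun n => {x | Λ n x = y.1 n})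
      (fun n x hx => by
        have h := congrArg Subtype.val (y.2 n)
        change Λ n x = (y.1 n).1
        rw [h, hΛM n x, show Λ (n + 1) x = (y.1 (n + 1)).1 from hx])
      (fun n => hsurj n _ (y.1 n).2) (hclosed 0).isCompact hclosed
    exact ⟨x, Subtype.ext (funext fun n => Subtype.ext (Set.mem_iInter.1 hx n))⟩
  refine ⟨P, inferInstance, f, fun n => ?_, fun n => ?_,
    hφ.homeoOfEquivCompactToT2 (f := Equiv.ofBijective φ ⟨hinj, hφsurj⟩), fun n x y hxy => ?_⟩
  · exact ⟨(E n).isPolyhedron_range,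
      isConnected_iff_connectedSpace.1 (isConnected_range (E n).continuous)⟩
  · refine ⟨hf n, fun t => ?_⟩
    obtain ⟨x, hx⟩ := hsurj n t t.2
    exact ⟨_, (hcomm n x).symm.trans (Subtype.ext hx)⟩
  · exact (hsmall n x y (congrArg Subtype.val hxy)).trans_le (min_le_left _ _)

theorem mainTheorem3 (X : Type*) [MetricSpace X] [CompactSpace X] [ConnectedSpace X]
    (n₀ m₀ : ℕ) (h₀ : n₀ ≤ m₀) :
    ¬ HasFixedPointProperty X ↔
      ∃ (P : ℕ → Type) (_ : ∀ l, TopologicalSpace (P l)) (f : ∀ l, P (l + 1) → P l),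
        (∀ l, IsPolyhedron (P l) ∧ ConnectedSpace (P l)) ∧
        (∀ l, Continuous (f l) ∧ Function.Surjective (f l)) ∧
        Nonempty (InverseSequence.limit f ≃ₜ X) ∧
        ∃ g : InverseSequence.limit f → InverseSequence.limit f, Continuous g ∧
          ∀ x : P m₀, InverseSequence.bond f h₀ x ∉ InverseSequence.transform n₀ m₀ g x := by
  constructor
  · intro hX
    unfold HasFixedPointProperty at hX
    push Not at hX
    obtain ⟨h, hcont, hfix⟩ := hX
    obtain ⟨x₀, hx₀⟩ := (continuous_dist.comp (hcont.prodMk continuous_id)).exists_forall_le'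
      (f := fun x => dist (h x) x) (Classical.arbitrary X) (by simp)
    -- The least displacement of `h`, attained at `x₀`, serves as `ε`.
    obtain ⟨P, hP, f, hpoly, hf, φ, hφ⟩ :=
      exists_polyhedral_expansion X (dist_pos.2 (hfix x₀))
    refine ⟨P, hP, f, hpoly, hf, ⟨φ.symm⟩, fun y => φ (h (φ.symm y)),
      φ.continuous.comp (hcont.comp φ.symm.continuous), fun x => ?_⟩
    refine InverseSequence.bond_notMem_transform h₀ (fun y hy => ?_) x
    obtain ⟨x, rfl⟩ := φ.surjective y
    rw [φ.symm_apply_apply] at hy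
    exact absurd (hφ n₀ _ _ hy) (not_lt.2 (hx₀ x))
  · rintro ⟨P, hP, f, -, -, ⟨φ⟩, g, hg, hgx⟩ hX
    obtain ⟨x, hx⟩ := hX (fun x => φ (g (φ.symm x)))
      (φ.continuous.comp (hg.comp φ.symm.continuous))
    refine InverseSequence.proj_ne_of_bond_notMem_transform h₀ hgx (φ.symm x) ?_
    rw [← φ.symm_apply_apply (g (φ.symm x)), hx]
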